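/- Let $K$ be a field of characteristic zero, let $n\ge 2$ and $d\ge 2$ be integers, and let $P=P\langle x_1,\ldots,x_n\rangle$ be the free Poisson algebra over $K$ in the variables $x_1,\ldots,x_n$, i.e. the symmetric algebra of the free Lie algebra on $x_1,\ldots,x_n$, with the bracket $\{\cdot,\cdot\}$ that extends the Lie bracket by the Leibniz rule. For $i\in\mathbb{Z}/d\mathbb{Z}$ let $P_i$ be the linear span of all homogeneous elements of $P$ of degree congruent to $i$ modulo $d$, where $\deg x_j=1$ for all $j$; in particular $P_0$ is a Poisson subalgebra, the Veronese subalgebra of $P$ of degree $d$. A derivation of a Poisson algebra is a linear map $D$ with $D(fg)=D(f)g+fD(g)$ and $D(\{f,g\})=\{D(f),g\}+\{f,D(g)\}$ for all $f,g$; it is locally nilpotent if for every $f$ there is $k\ge 0$ with $D^k(f)=0$; and a derivation $S$ of $P$ is $d$-graded if $S(x_1),\ldots,S(x_n)\in P_1$. Then every locally nilpotent derivation $D$ of the Poisson algebra $P_0$ is induced by a locally nilpotent $d$-graded derivation of $P$: there is a $d$-graded derivation $S$ of the Poisson algebra $P$ that is locally nilpotent and satisfies $S(f)=D(f)$ for all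 $f\in P_0$. -/

import Mathlib

/-! ### Poisson algebras and their derivations -/

/-- A Poisson algebra structure on a commutative associative algebra `P` over `K`: a bilinear Lie
bracket on `P` satisfying the Leibniz identity. -/
class PoissonAlgebra (K P : Type*) [CommRing K] [CommRing P] [Algebra K P] where
  /-- the Poisson bracket -/
  bracket : P →ₗ[K] P →ₗ[K] P
  bracket_self : ∀ a, bracket a a = 0
  jacobi : ∀ a b c,
    bracket a (bracket b c) + bracket b (bracket c a) + bracket c (bracket a b) = 0
  leibniz : ∀ a b c, bracket a (b * c) = b * bracket a c + bracket a b * c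

/-- A derivation of a Poisson algebra: a `K`-linear map that is simultaneously a derivation of the
associative multiplication and of the Lie bracket. -/
structure IsPoissonDerivation {K P : Type*} [CommRing K] [CommRing P] [Algebra K P]
    [PoissonAlgebra K P] (D : P →ₗ[K] P) : Prop where
  map_mul : ∀ a b, D (a * b) = D a * b + a * D b
  map_bracket : ∀ a b, D (PoissonAlgebra.bracket (K := K) a b) =
    PoissonAlgebra.bracket (K := K) (D a) b + PoissonAlgebra.bracket (K := K) a (D b)

/-- A linear map `D` is locally nilpotent if every element is annihilated by some power of `D`. -/
def IsLocallyNilpotent {K P : Type*} [CommRing K] [AddCommGroup P] [Module K P]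
    (D : P →ₗ[K] P) : Prop :=
  ∀ a : P, ∃ k : ℕ, D^[k] a = 0

/-! ### The Poisson enveloping algebra of a Lie algebra

The bracket of the Lie algebra `L` extends to the symmetric algebra of `L` by the Leibniz rule. -/

noncomputable section

namespace PoissonEnveloping

variable {K L : Type*} [CommRing K] [LieRing L] [LieAlgebra K L]

/-- The derivation of the symmetric algebra that extends a linear map given on generators. -/
def extend (φ : L →ₗ[K] SymmetricAlgebra K L) :
    Derivation K (SymmetricAlgebra K L) (SymmetricAlgebra K L) :=
  let F : SymmetricAlgebra K L →ₐ[K]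
      TrivSqZeroExt (SymmetricAlgebra K L) (SymmetricAlgebra K L) :=
    SymmetricAlgebra.lift
      ((TrivSqZeroExt.inlAlgHom K (SymmetricAlgebra K L) (SymmetricAlgebra K L)).toLinearMap ∘ₗ
          SymmetricAlgebra.ι K L +
        (TrivSqZeroExt.inrHom (SymmetricAlgebra K L) (SymmetricAlgebra K L)).restrictScalars K ∘ₗ φ)
  have hF : ∀ a, (F a).fst = a := by
    intro a
    have h : (TrivSqZeroExt.fstHom K (SymmetricAlgebra K L) (SymmetricAlgebra K L)).comp F =
        AlgHom.id K _ := by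
      apply SymmetricAlgebra.algHom_ext
      ext x
      simp [F]
    exact congrArg (fun f : SymmetricAlgebra K L →ₐ[K] SymmetricAlgebra K L => f a) h
  Derivation.mk'
    ((TrivSqZeroExt.sndHom (SymmetricAlgebra K L) (SymmetricAlgebra K L)).restrictScalars K ∘ₗ
      F.toLinearMap)
    (by
      intro a b
      simp [TrivSqZeroExt.snd_mul, hF, mul_comm])

theorem extend_ι (φ : L →ₗ[K] SymmetricAlgebra K L) (x : L) :
    extend φ (SymmetricAlgebra.ι K L x) = φ x := by
  simp [extend]

theorem derivation_ext {D E : Derivation K (SymmetricAlgebra K L) (SymmetricAlgebra K L)}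
    (h : ∀ x, D (SymmetricAlgebra.ι K L x) = E (SymmetricAlgebra.ι K L x)) : D = E := by
  ext a
  induction a using SymmetricAlgebra.induction with
  | algebraMap r => simp
  | ι x => exact h x
  | mul a b ha hb => simp [ha, hb]
  | add a b ha hb => simp [ha, hb]

/-- `adGen x` is the derivation `a ↦ {x, a}` for `x` in the Lie algebra. -/
def adGen : L →ₗ[K] Derivation K (SymmetricAlgebra K L) (SymmetricAlgebra K L) where
  toFun x := extend (SymmetricAlgebra.ι K L ∘ₗ (LieAlgebra.ad K L x : L →ₗ[K] L))
  map_add' x y := derivation_ext fun z => by simp [extend_ι]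
  map_smul' r x := derivation_ext fun z => by simp [extend_ι]

theorem adGen_ι (x y : L) :
    adGen x (SymmetricAlgebra.ι K L y) = SymmetricAlgebra.ι K L ⁅x, y⁆ := by
  simp [adGen, extend_ι]

/-- `evalGen a` is the linear map `x ↦ {a, x}` for `x` in the Lie algebra. -/
def evalGen (a : SymmetricAlgebra K L) : L →ₗ[K] SymmetricAlgebra K L where
  toFun x := -adGen x a
  map_add' x y := by simp [add_comm]
  map_smul' r x := by simp

/-- The derivation `b ↦ {a, b}`. -/
def bracketDer : SymmetricAlgebra K L →ₗ[K]
    Derivation K (SymmetricAlgebra K L) (SymmetricAlgebra K L) where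
  toFun a := extend (evalGen a)
  map_add' a b := derivation_ext fun z => by simp [extend_ι, evalGen, add_comm]
  map_smul' r a := derivation_ext fun z => by simp [extend_ι, evalGen]

theorem bracketDer_apply_ι (a : SymmetricAlgebra K L) (x : L) :
    bracketDer a (SymmetricAlgebra.ι K L x) = -adGen x a := by
  simp [bracketDer, extend_ι, evalGen]

theorem bracketDer_ι (x : L) : bracketDer (SymmetricAlgebra.ι K L x) = adGen x := by
  apply derivation_ext
  intro y
  rw [bracketDer_apply_ι, adGen_ι, adGen_ι, ← map_neg, lie_skew]

theorem bracketDer_mul (a b : SymmetricAlgebra K L) :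
    bracketDer (a * b) = a • bracketDer b + b • bracketDer a := by
  apply derivation_ext
  intro x
  simp [bracketDer_apply_ι, add_comm]

theorem bracketDer_algebraMap (r : K) :
    bracketDer (algebraMap K (SymmetricAlgebra K L) r) = 0 := by
  apply derivation_ext
  intro x
  simp [bracketDer_apply_ι]

theorem bracketDer_skew (a b : SymmetricAlgebra K L) : bracketDer a b = -bracketDer b a := by
  induction b using SymmetricAlgebra.induction with
  | algebraMap r => simp [bracketDer_algebraMap]
  | ι x => rw [bracketDer_apply_ι, bracketDer_ι]
  | mul b c hb hc => simp [bracketDer_mul, hb, hc]; ring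
  | add b c hb hc => simp [hb, hc]; ring

theorem bracketDer_self (a : SymmetricAlgebra K L) : bracketDer a a = 0 := by
  induction a using SymmetricAlgebra.induction with
  | algebraMap r => simp
  | ι x => rw [bracketDer_ι, adGen_ι]; simp
  | mul a b ha hb =>
    simp only [bracketDer_mul, Derivation.add_apply, Derivation.smul_apply, Derivation.leibniz,
      ha, hb, smul_eq_mul]
    rw [bracketDer_skew a b]; ring
  | add a b ha hb =>
    simp only [map_add, Derivation.add_apply, ha, hb]
    rw [bracketDer_skew a b]; ring

theorem adGen_lie_ι (x : L) (b c : SymmetricAlgebra K L) :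
    adGen x (bracketDer b c) = bracketDer (adGen x b) c + bracketDer b (adGen x c) := by
  induction b using SymmetricAlgebra.induction with
  | algebraMap r => simp [bracketDer_algebraMap]
  | mul a b ha hb => simp [bracketDer_mul, ha, hb]; ring
  | add a b ha hb => simp [ha, hb]; ring
  | ι y =>
    induction c using SymmetricAlgebra.induction with
    | algebraMap r => simp
    | ι z =>
      simp only [bracketDer_ι, adGen_ι]
      rw [← map_add]
      congr 1
      rw [leibniz_lie]
    | mul a b ha hb => simp [ha, hb]; ring
    | add a b ha hb => simp [ha, hb]; ring

theorem bracketDer_lie (a b c : SymmetricAlgebra K L) :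
    bracketDer a (bracketDer b c) =
      bracketDer (bracketDer a b) c + bracketDer b (bracketDer a c) := by
  induction a using SymmetricAlgebra.induction with
  | algebraMap r => simp [bracketDer_algebraMap]
  | ι x => simpa only [bracketDer_ι] using adGen_lie_ι x b c
  | add a b ha hb => simp [ha, hb]; ring
  | mul a a' ha hb =>
    simp only [bracketDer_mul, Derivation.add_apply, Derivation.smul_apply, Derivation.leibniz,
      ha, hb, smul_eq_mul, map_add]
    rw [bracketDer_skew b a, bracketDer_skew b a']
    ring

end PoissonEnveloping

/-- The symmetric algebra of a Lie algebra `L`, i.e. the polynomial algebra on a basis of `L` when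
`L` has one, is a Poisson algebra: the Poisson enveloping algebra `P(L)`. -/
instance SymmetricAlgebra.instPoissonAlgebra {K L : Type*} [CommRing K] [LieRing L]
    [LieAlgebra K L] : PoissonAlgebra K (SymmetricAlgebra K L) where
  bracket :=
    { toFun := fun a => (PoissonEnveloping.bracketDer a : SymmetricAlgebra K L →ₗ[K] _)
      map_add' := fun a b => by simp
      map_smul' := fun r a => by simp }
  bracket_self a := PoissonEnveloping.bracketDer_self a
  jacobi a b c := by
    change PoissonEnveloping.bracketDer a (PoissonEnveloping.bracketDer b c) +
      PoissonEnveloping.bracketDer b (PoissonEnveloping.bracketDer c a) +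
      PoissonEnveloping.bracketDer c (PoissonEnveloping.bracketDer a b) = 0
    rw [PoissonEnveloping.bracketDer_lie,
      PoissonEnveloping.bracketDer_skew (PoissonEnveloping.bracketDer a b) c,
      PoissonEnveloping.bracketDer_skew c a, map_neg]
    ring
  leibniz a b c := by
    change PoissonEnveloping.bracketDer a (b * c) =
      b * PoissonEnveloping.bracketDer a c + PoissonEnveloping.bracketDer a b * c
    rw [Derivation.leibniz, smul_eq_mul, smul_eq_mul, mul_comm c]

/-- The bracket of `P(L)` restricts to the Lie bracket of `L`. -/
theorem SymmetricAlgebra.bracket_ι_ι {K L : Type*} [CommRing K] [LieRing L] [LieAlgebra K L]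
    (x y : L) :
    PoissonAlgebra.bracket (K := K) (SymmetricAlgebra.ι K L x) (SymmetricAlgebra.ι K L y) =
      SymmetricAlgebra.ι K L ⁅x, y⁆ := by
  change PoissonEnveloping.bracketDer _ _ = _
  rw [PoissonEnveloping.bracketDer_ι, PoissonEnveloping.adGen_ι]

/-! ### Free Poisson algebras and their gradings -/

/-- The free Poisson algebra `P⟨x_1, …, x_n⟩` over `K`: the Poisson enveloping algebra of the free
Lie algebra on `n` generators. -/
abbrev FreePoissonAlgebra (K : Type*) [CommRing K] (n : ℕ) :=
  SymmetricAlgebra K (FreeLieAlgebra K (Fin n))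

namespace FreePoissonAlgebra

variable (K : Type*) [CommRing K] (n : ℕ)

/-- The free generators `x_i`. -/
def X (i : Fin n) : FreePoissonAlgebra K n :=
  SymmetricAlgebra.ι K (FreeLieAlgebra K (Fin n)) (FreeLieAlgebra.of K i)

/-- `IsLieMonomial K n m e`: `e` is an iterated bracket of `m` generators, hence a homogeneous
element of degree `m` of the free Lie algebra. -/
inductive IsLieMonomial : ℕ → FreeLieAlgebra K (Fin n) → Prop
  | of (i : Fin n) : IsLieMonomial 1 (FreeLieAlgebra.of K i)
  | lie {k m : ℕ} {a b : FreeLieAlgebra K (Fin n)} :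
      IsLieMonomial k a → IsLieMonomial m b → IsLieMonomial (k + m) ⁅a, b⁆

/-- `IsMonomial K n m u`: `u` is a product `e_1 ⋯ e_s` of Lie monomials (`s ≥ 0`) with
`deg e_1 + ⋯ + deg e_s = m`. -/
inductive IsMonomial : ℕ → FreePoissonAlgebra K n → Prop
  | one : IsMonomial 0 1
  | mul {k m : ℕ} {e : FreeLieAlgebra K (Fin n)} {u : FreePoissonAlgebra K n} :
      IsLieMonomial K n k e → IsMonomial m u →
        IsMonomial (k + m) (SymmetricAlgebra.ι K (FreeLieAlgebra K (Fin n)) e * u)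

/-- The space of homogeneous elements of degree `m` of the free Poisson algebra. -/
def homogeneous (m : ℕ) : Submodule K (FreePoissonAlgebra K n) :=
  Submodule.span K {u | IsMonomial K n m u}

/-- The component `P_i`, `i ∈ ℤ/d`, of the `d`-grading: the span of the homogeneous elements of
degree congruent to `i` modulo `d`. -/
def dComponent (d : ℕ) (i : ZMod d) : Submodule K (FreePoissonAlgebra K n) :=
  Submodule.span K {f | ∃ m : ℕ, (m : ZMod d) = i ∧ f ∈ homogeneous K n m}

variable {K n}

theorem IsMonomial.mul_mem {k m : ℕ} {u v : FreePoissonAlgebra K n}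
    (hu : IsMonomial K n k u) (hv : IsMonomial K n m v) : IsMonomial K n (k + m) (u * v) := by
  induction hu with
  | one => simpa using hv
  | mul he _ ih => rw [mul_assoc, add_assoc]; exact .mul he ih

theorem homogeneous_mul {k m : ℕ} {f g : FreePoissonAlgebra K n}
    (hf : f ∈ homogeneous K n k) (hg : g ∈ homogeneous K n m) :
    f * g ∈ homogeneous K n (k + m) := by
  induction hf using Submodule.span_induction with
  | zero => simp
  | add a b _ _ ha hb => rw [add_mul]; exact add_mem ha hb
  | smul r a _ ha => rw [smul_mul_assoc]; exact Submodule.smul_mem _ _ ha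
  | mem u hu =>
    induction hg using Submodule.span_induction with
    | zero => simp
    | add a b _ _ ha hb => rw [mul_add]; exact add_mem ha hb
    | smul r a _ ha => rw [mul_smul_comm]; exact Submodule.smul_mem _ _ ha
    | mem v hv => exact Submodule.subset_span (hu.mul_mem hv)

theorem ι_mem_homogeneous {k : ℕ} {e : FreeLieAlgebra K (Fin n)} (he : IsLieMonomial K n k e) :
    SymmetricAlgebra.ι K (FreeLieAlgebra K (Fin n)) e ∈ homogeneous K n k := by
  have := IsMonomial.mul he .one
  rw [mul_one, add_zero] at this
  exact Submodule.subset_span this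

theorem one_mem_homogeneous : (1 : FreePoissonAlgebra K n) ∈ homogeneous K n 0 :=
  Submodule.subset_span .one

theorem bracket_ι_mem {k m : ℕ} {e : FreeLieAlgebra K (Fin n)} {v : FreePoissonAlgebra K n}
    (he : IsLieMonomial K n k e) (hv : IsMonomial K n m v) :
    PoissonAlgebra.bracket (K := K) (SymmetricAlgebra.ι K _ e) v ∈ homogeneous K n (k + m) := by
  induction hv with
  | one =>
    change PoissonEnveloping.bracketDer _ _ ∈ _
    simp
  | @mul p q e' u he' hu ih =>
    rw [PoissonAlgebra.leibniz, SymmetricAlgebra.bracket_ι_ι]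
    refine add_mem ?_ ?_
    · rw [show k + (p + q) = p + (k + q) by ring]
      exact homogeneous_mul (ι_mem_homogeneous he') ih
    · rw [← add_assoc]
      exact homogeneous_mul (ι_mem_homogeneous (.lie he he')) (Submodule.subset_span hu)

theorem bracket_monomial_mem {k m : ℕ} {u v : FreePoissonAlgebra K n}
    (hu : IsMonomial K n k u) (hv : IsMonomial K n m v) :
    PoissonAlgebra.bracket (K := K) u v ∈ homogeneous K n (k + m) := by
  induction hu with
  | one =>
    change PoissonEnveloping.bracketDer _ _ ∈ _
    rw [PoissonEnveloping.bracketDer_skew]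
    simp
  | @mul p q e u he hu ih =>
    have h : PoissonAlgebra.bracket (K := K) (SymmetricAlgebra.ι K _ e * u) v =
        SymmetricAlgebra.ι K _ e * PoissonAlgebra.bracket (K := K) u v +
          u * PoissonAlgebra.bracket (K := K) (SymmetricAlgebra.ι K _ e) v := by
      change PoissonEnveloping.bracketDer _ _ = _
      rw [PoissonEnveloping.bracketDer_mul]
      rfl
    rw [h]
    refine add_mem ?_ ?_
    · rw [add_assoc]
      exact homogeneous_mul (ι_mem_homogeneous he) ih
    · rw [show p + q + m = q + (p + m) by ring]
      exact homogeneous_mul (Submodule.subset_span hu) (bracket_ι_mem he hv)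

theorem bracket_homogeneous_mem {k m : ℕ} {f g : FreePoissonAlgebra K n}
    (hf : f ∈ homogeneous K n k) (hg : g ∈ homogeneous K n m) :
    PoissonAlgebra.bracket (K := K) f g ∈ homogeneous K n (k + m) := by
  induction hf using Submodule.span_induction with
  | zero => simp
  | add a b _ _ ha hb => rw [map_add]; exact add_mem ha hb
  | smul r a _ ha => rw [map_smul]; exact Submodule.smul_mem _ _ ha
  | mem u hu =>
    induction hg using Submodule.span_induction with
    | zero => simp
    | add a b _ _ ha hb => rw [map_add]; exact add_mem ha hb
    | smul r a _ ha => rw [map_smul]; exact Submodule.smul_mem _ _ ha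
    | mem v hv => exact bracket_monomial_mem hu hv

theorem dComponent_mul {d : ℕ} {i j : ZMod d} {f g : FreePoissonAlgebra K n}
    (hf : f ∈ dComponent K n d i) (hg : g ∈ dComponent K n d j) :
    f * g ∈ dComponent K n d (i + j) := by
  induction hf using Submodule.span_induction with
  | zero => simp
  | add a b _ _ ha hb => rw [add_mul]; exact add_mem ha hb
  | smul r a _ ha => rw [smul_mul_assoc]; exact Submodule.smul_mem _ _ ha
  | mem u hu =>
    induction hg using Submodule.span_induction with
    | zero => simp
    | add a b _ _ ha hb => rw [mul_add]; exact add_mem ha hb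
    | smul r a _ ha => rw [mul_smul_comm]; exact Submodule.smul_mem _ _ ha
    | mem v hv =>
      obtain ⟨k, hk, hu⟩ := hu
      obtain ⟨m, hm, hv⟩ := hv
      exact Submodule.subset_span ⟨k + m, by push_cast; rw [hk, hm], homogeneous_mul hu hv⟩

theorem dComponent_bracket {d : ℕ} {i j : ZMod d} {f g : FreePoissonAlgebra K n}
    (hf : f ∈ dComponent K n d i) (hg : g ∈ dComponent K n d j) :
    PoissonAlgebra.bracket (K := K) f g ∈ dComponent K n d (i + j) := by
  induction hf using Submodule.span_induction with
  | zero => simp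
  | add a b _ _ ha hb => rw [map_add]; exact add_mem ha hb
  | smul r a _ ha => rw [map_smul]; exact Submodule.smul_mem _ _ ha
  | mem u hu =>
    induction hg using Submodule.span_induction with
    | zero => simp
    | add a b _ _ ha hb => rw [map_add]; exact add_mem ha hb
    | smul r a _ ha => rw [map_smul]; exact Submodule.smul_mem _ _ ha
    | mem v hv =>
      obtain ⟨k, hk, hu⟩ := hu
      obtain ⟨m, hm, hv⟩ := hv
      exact Submodule.subset_span
        ⟨k + m, by push_cast; rw [hk, hm], bracket_homogeneous_mem hu hv⟩

variable (K n)

/-- The Veronese subalgebra `P_0` of degree `d`. -/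
def veronese (d : ℕ) : Subalgebra K (FreePoissonAlgebra K n) :=
  (dComponent K n d 0).toSubalgebra
    (Submodule.subset_span ⟨0, by simp, one_mem_homogeneous⟩)
    (fun f g hf hg => by simpa using dComponent_mul hf hg)

variable {K n}

theorem mem_veronese {d : ℕ} {f : FreePoissonAlgebra K n} :
    f ∈ veronese K n d ↔ f ∈ dComponent K n d 0 := Iff.rfl

/-- The Veronese subalgebra is closed under the bracket. -/
theorem bracket_mem_veronese {d : ℕ} (f g : veronese K n d) :
    PoissonAlgebra.bracket (K := K) (f : FreePoissonAlgebra K n) (g : FreePoissonAlgebra K n) ∈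
      veronese K n d := by
  have := dComponent_bracket (mem_veronese.1 f.2) (mem_veronese.1 g.2)
  rwa [add_zero] at this

/-- The Veronese subalgebra is a Poisson algebra with the restricted operations. -/
instance instPoissonAlgebraVeronese (d : ℕ) : PoissonAlgebra K (veronese K n d) where
  bracket := LinearMap.mk₂ K
    (fun f g => ⟨PoissonAlgebra.bracket (K := K) (f : FreePoissonAlgebra K n)
      (g : FreePoissonAlgebra K n), bracket_mem_veronese f g⟩)
    (fun a b c => Subtype.ext (by simp))
    (fun r a b => Subtype.ext (by simp))
    (fun a b c => Subtype.ext (by simp))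
    (fun r a b => Subtype.ext (by simp))
  bracket_self a := Subtype.ext (PoissonAlgebra.bracket_self (K := K) _)
  jacobi a b c := Subtype.ext (PoissonAlgebra.jacobi (K := K) _ _ _)
  leibniz a b c := Subtype.ext (PoissonAlgebra.leibniz (K := K) _ _ _)

/-- A `d`-graded Poisson derivation of `P⟨x_1, …, x_n⟩`: a Poisson derivation `D` with
`D x_i ∈ P_1` for all `i`. -/
structure IsDGradedPoissonDerivation (d : ℕ)
    (D : FreePoissonAlgebra K n →ₗ[K] FreePoissonAlgebra K n) : Prop where
  isPoissonDerivation : IsPoissonDerivation D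
  map_X_mem : ∀ i : Fin n, D (X K n i) ∈ dComponent K n d 1

end FreePoissonAlgebra

end

/-! ### Derivations of graded domains -/

section GradedDomain

variable {K A : Type*} [Field K] [CommRing A] [Algebra K A]

/-! Every homogeneous `f` has `f ^ d` in `P_0`, and `P` is a domain of characteristic zero, so a
derivation of `P` is controlled by its restriction to `P_0`.

Extension (`exists_derivation_extension`). Let `x = x_1`, `y = x_2`. If `f` has degree `j` and `k ≡
-j`, then `f * x ^ k` lies in `P_0`, and the Leibniz rule forces `d x^{2d} T f = d x^{2d-k} δ(f x^k)
- k f x^d δ(x^d)`, where `δ` is the given derivation. The right side defines a derivation `E` of the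
commutative algebra `P`. The same expansion with `y` in place of `x` shows that `x ^ (2 * d)`
divides a power of `y` times `E f`. Since `x` is prime and does not divide `y`, it divides `E f`,
and `T` is the quotient.

Properties of `T`. It preserves degrees because `T (f ^ d) = d f^{d-1} T f` (`derivation_mem`).
Nilpotency orders add under multiplication, and comparing orders in the `d`-th power of this
identity shows that they drop (`isLocallyNilpotent`). The failure of `T` to respect the bracket is a
skew biderivation vanishing on `P_0`, hence zero (`derivation_bracket`).

The grading itself is direct because scaling the generators by `2` acts on degree `m` as `2 ^ m`
(`iSupIndep_homogeneous`). -/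

theorem Derivation.iterate_mul (T : Derivation K A A) (n : ℕ) (a b : A) :
    T^[n] (a * b) =
      ∑ ij ∈ Finset.HasAntidiagonal.antidiagonal n, n.choose ij.1 • (T^[ij.1] a * T^[ij.2] b) := by
  induction n with
  | zero => simp
  | succ n ih =>
    rw [Finset.sum_antidiagonal_choose_succ_nsmul (M := A) (fun i j => T^[i] a * T^[j] b) n]
    simp only [Function.iterate_succ_apply', ih, map_sum, map_nsmul, Derivation.leibniz,
      smul_eq_mul, smul_add, Finset.sum_add_distrib]
    congr 1
    refine Finset.sum_congr rfl fun ij hij => ?_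
    rw [Nat.choose_symm_of_eq_add (Finset.HasAntidiagonal.mem_antidiagonal.1 hij).symm, mul_comm]

/-- `T` has nilpotency order `m` at `a` if `T ^ m a ≠ 0` and `T ^ (m + 1) a = 0`. -/
def Derivation.HasNilOrder (T : Derivation K A A) (a : A) (m : ℕ) : Prop :=
  T^[m] a ≠ 0 ∧ T^[m + 1] a = 0

namespace Derivation

variable {T : Derivation K A A} {a b : A} {m k : ℕ}

theorem iterate_eq_zero_of_le (h : T^[m] a = 0) (hmk : m ≤ k) : T^[k] a = 0 := by
  obtain ⟨j, rfl⟩ := Nat.exists_eq_add_of_le' hmk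
  rw [Function.iterate_add_apply, h, iterate_map_zero]

theorem HasNilOrder.unique (h : T.HasNilOrder a m) (h' : T.HasNilOrder a k) : m = k := by
  by_contra hne
  rcases Nat.lt_or_gt_of_ne hne with hlt | hlt
  · exact h'.1 (iterate_eq_zero_of_le h.2 hlt)
  · exact h.1 (iterate_eq_zero_of_le h'.2 hlt)

theorem exists_hasNilOrder (ha : a ≠ 0) (h : T^[m] a = 0) : ∃ j < m, T.HasNilOrder a j := by
  induction m with
  | zero => exact absurd h ha
  | succ m ih =>
    by_cases hm : T^[m] a = 0
    · obtain ⟨j, hj, hj'⟩ := ih hm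
      exact ⟨j, by omega, hj'⟩
    · exact ⟨m, by omega, hm, h⟩

/-- In the binomial expansion of `T^[m + k] (a * b)` only the term `(m, k)` survives, and its
coefficient is nonzero in characteristic zero; one step further no term survives. -/
theorem HasNilOrder.mul [CharZero K] [IsDomain A] (ha : T.HasNilOrder a m) (hb : T.HasNilOrder b k) :
    T.HasNilOrder (a * b) (m + k) := by
  have : CharZero A := charZero_of_injective_algebraMap (algebraMap K A).injective
  constructor
  · rw [iterate_mul, Finset.sum_eq_single (m, k)]
    · rw [nsmul_eq_mul]
      refine mul_ne_zero ?_ (mul_ne_zero ha.1 hb.1)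
      exact_mod_cast (Nat.choose_pos (Nat.le_add_right m k)).ne'
    · rintro ⟨i, j⟩ hij hne
      rw [Finset.HasAntidiagonal.mem_antidiagonal] at hij
      rcases Nat.lt_trichotomy i m with h | h | h
      · rw [iterate_eq_zero_of_le hb.2 (by dsimp at hij ⊢; omega)]; simp
      · exact absurd (Prod.ext h (by dsimp at hij ⊢; omega)) hne
      · rw [iterate_eq_zero_of_le ha.2 h]; simp
    · simp
  · rw [iterate_mul]
    refine Finset.sum_eq_zero ?_
    rintro ⟨i, j⟩ hij
    rw [Finset.HasAntidiagonal.mem_antidiagonal] at hij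
    rcases Nat.lt_or_ge m i with h | h
    · rw [iterate_eq_zero_of_le ha.2 h]; simp
    · rw [iterate_eq_zero_of_le hb.2 (by dsimp at hij ⊢; omega)]; simp

theorem HasNilOrder.pow [CharZero K] [IsDomain A] (ha : T.HasNilOrder a m) (j : ℕ) : T.HasNilOrder (a ^ j) (j * m) := by
  induction j with
  | zero => simp [HasNilOrder]
  | succ j ih => rw [pow_succ, Nat.succ_mul]; exact ih.mul ha

end Derivation

variable {ι : Type*} [DecidableEq ι] [AddCommGroup ι]

/-- Multiplication by `g` shifts components, so `g * h` equals `g` times the degree `j` component of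
`h`; cancel `g`. -/
theorem GradedAlgebra.mem_of_mul_mem [IsDomain A] (𝒜 : ι → Submodule K A) [GradedAlgebra 𝒜] {i j : ι}
    {g h : A} (hg : g ∈ 𝒜 i) (hg0 : g ≠ 0) (hgh : g * h ∈ 𝒜 (i + j)) : h ∈ 𝒜 j := by
  have h1 := DirectSum.coe_decompose_mul_add_of_left_mem 𝒜 (b := h) (j := j) hg
  rw [DirectSum.decompose_of_mem_same 𝒜 hgh] at h1
  rw [mul_left_cancel₀ hg0 h1]
  exact SetLike.coe_mem _

variable {d : ℕ} (𝒜 : ZMod d → Submodule K A) [GradedAlgebra 𝒜]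

theorem GradedAlgebra.pow_mem_zero {i : ZMod d} {f : A} (hf : f ∈ 𝒜 i) : f ^ d ∈ 𝒜 0 := by
  simpa using SetLike.pow_mem_graded d hf

/-- A derivation of a `ZMod d`-graded domain preserves the grading if it maps the degree zero
component to itself. -/
theorem GradedAlgebra.derivation_mem [CharZero K] [IsDomain A] (hd : d ≠ 0) (T : Derivation K A A)
    (hT : ∀ f ∈ 𝒜 0, T f ∈ 𝒜 0) {i : ZMod d} {f : A} (hf : f ∈ 𝒜 i) : T f ∈ 𝒜 i := by
  rcases eq_or_ne f 0 with rfl | hf0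
  · simp
  have h1 := hT _ (pow_mem_zero 𝒜 hf)
  rw [Derivation.leibniz_pow, ← Nat.cast_smul_eq_nsmul K,
    Submodule.smul_mem_iff _ (Nat.cast_ne_zero.2 hd), smul_eq_mul] at h1
  refine mem_of_mul_mem 𝒜 (SetLike.pow_mem_graded (d - 1) hf) (pow_ne_zero _ hf0) ?_
  convert! h1
  -- The degrees match: `(d - 1) • i + i = d • i = 0`.
  rw [← succ_nsmul, Nat.sub_add_cancel (Nat.pos_of_ne_zero hd)]
  simp

/-- A derivation of a `ZMod d`-graded domain that restricts to a locally nilpotent derivation of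
the degree zero component is locally nilpotent. -/
theorem GradedAlgebra.isLocallyNilpotent [CharZero K] [IsDomain A] (hd : 2 ≤ d) (T : Derivation K A A)
    (hT : ∀ f ∈ 𝒜 0, T f ∈ 𝒜 0) (hnil : ∀ f ∈ 𝒜 0, ∃ k : ℕ, T^[k] f = 0) :
    IsLocallyNilpotent (T : A →ₗ[K] A) := by
  have : CharZero A := charZero_of_injective_algebraMap (algebraMap K A).injective
  -- Nilpotency at `f` is not yet known, so the induction runs on the order of `f ^ d`, which exists
  -- because `f ^ d` has degree zero.
  have key : ∀ (m : ℕ) (i : ZMod d) (f : A), f ∈ 𝒜 i → T.HasNilOrder (f ^ d) m →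
      ∃ k : ℕ, T^[k] f = 0 := by
    intro m
    induction m using Nat.strong_induction_on with
    | _ m ih =>
    intro i f hf hm
    have hTf := derivation_mem 𝒜 (by omega) T hT hf
    rcases eq_or_ne (T f) 0 with h0 | h0
    · exact ⟨1, h0⟩
    obtain ⟨k, hk⟩ := hnil _ (pow_mem_zero 𝒜 hTf)
    obtain ⟨q, -, hq⟩ := Derivation.exists_hasNilOrder (pow_ne_zero d h0) hk
    have hf0 : f ≠ 0 := by rintro rfl; simp at h0
    have hTa : T (f ^ d) = d * (f ^ (d - 1) * T f) := by
      rw [Derivation.leibniz_pow]; simp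
    have hTa0 : T (f ^ d) ≠ 0 := by
      rw [hTa]
      exact mul_ne_zero (Nat.cast_ne_zero.2 (by omega)) (mul_ne_zero (pow_ne_zero _ hf0) h0)
    obtain ⟨p, rfl⟩ : ∃ p, m = p + 1 := by
      refine Nat.exists_eq_succ_of_ne_zero ?_
      rintro rfl
      exact hTa0 hm.2
    have hTm : T.HasNilOrder (T (f ^ d)) p := hm
    have hconst : T.HasNilOrder ((d : A) ^ d) 0 := by
      refine ⟨pow_ne_zero _ (Nat.cast_ne_zero.2 (by omega)), ?_⟩
      simp [Derivation.leibniz_pow]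
    have h1 := hTm.pow d
    have h2 := hconst.mul ((hm.pow (d - 1)).mul hq)
    have h3 : T (f ^ d) ^ d = (d : A) ^ d * ((f ^ d) ^ (d - 1) * T f ^ d) := by
      rw [hTa]; ring
    rw [h3] at h1
    have h4 := h1.unique h2
    -- The two orders give `d * p = (d - 1) * (p + 1) + q`, that is, `q = p - (d - 1)`.
    obtain ⟨e, rfl⟩ : ∃ e, d = e + 1 := ⟨d - 1, by omega⟩
    have hlt : q < p + 1 := by
      simp only [Nat.add_sub_cancel] at h4
      nlinarith
    obtain ⟨k, hk⟩ := ih q hlt i (T f) hTf hq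
    exact ⟨k + 1, hk⟩
  intro f
  change ∃ k : ℕ, T^[k] f = 0
  induction f using DirectSum.Decomposition.inductionOn 𝒜 with
  | zero => exact ⟨0, rfl⟩
  | @homogeneous i f =>
    rcases eq_or_ne (f : A) 0 with h0 | h0
    · exact ⟨0, h0⟩
    obtain ⟨k, hk⟩ := hnil _ (pow_mem_zero 𝒜 f.2)
    obtain ⟨m, -, hm⟩ := Derivation.exists_hasNilOrder (pow_ne_zero d h0) hk
    exact key m i f f.2 hm
  | add f g hf hg =>
    obtain ⟨k, hk⟩ := hf
    obtain ⟨l, hl⟩ := hg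
    refine ⟨max k l, ?_⟩
    rw [iterate_map_add, Derivation.iterate_eq_zero_of_le hk (le_max_left _ _),
      Derivation.iterate_eq_zero_of_le hl (le_max_right _ _), add_zero]

end GradedDomain

/-! ### Extending derivations from the degree zero component -/

section Extension

variable {K A : Type*} [Field K] [CommRing A] [Algebra K A]

/-- Quotients by `c` are unique in a domain, so each identity for `T` follows from that for `E` by
cancelling `c`. -/
theorem Derivation.exists_mul_eq [IsDomain A] (E : Derivation K A A) {c : A} (hc : c ≠ 0)
    (h : ∀ f, c ∣ E f) : ∃ T : Derivation K A A, ∀ f, c * T f = E f := by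
  choose t ht using h
  let T₀ : A →ₗ[K] A :=
    { toFun := t
      map_add' := fun f g => mul_left_cancel₀ hc <| by
        rw [mul_add, ← ht, ← ht, ← ht, map_add]
      map_smul' := fun r f => mul_left_cancel₀ hc <| by
        rw [RingHom.id_apply, mul_smul_comm, ← ht, ← ht, map_smul] }
  refine ⟨Derivation.mk' T₀ fun f g => mul_left_cancel₀ hc ?_, fun f => (ht f).symm⟩
  change c * t (f * g) = c * (f * t g + g * t f)
  rw [← ht, Derivation.leibniz, ht f, ht g, smul_eq_mul, smul_eq_mul]
  ring

namespace GradedAlgebra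

variable {d : ℕ}

/-- The power rule multiplied by `u`, which avoids the exponent `q - 1` and includes `q = 0`. -/
theorem mul_map_pow {𝒜 : ZMod d → Submodule K A} [GradedAlgebra 𝒜] {δ : A →ₗ[K] A}
    (hδ : ∀ f ∈ 𝒜 0, ∀ g ∈ 𝒜 0, δ (f * g) = δ f * g + f * δ g) {u : A} (hu : u ∈ 𝒜 0) (q : ℕ) : u * δ (u ^ q) = q * (u ^ q * δ u) := by
  have hq : ∀ q : ℕ, u ^ q ∈ 𝒜 0 := fun q => by simpa using SetLike.pow_mem_graded q hu
  induction q with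
  | zero =>
    have := hδ 1 (by simpa using hq 0) 1 (by simpa using hq 0)
    simp only [mul_one, one_mul, left_eq_add] at this
    simp [this]
  | succ q ih =>
    rw [pow_succ, hδ _ (hq q) _ hu, mul_add, ← mul_assoc, ih]
    push_cast
    ring

variable (𝒜 : ZMod d → Submodule K A) [GradedAlgebra 𝒜] (δ : A →ₗ[K] A) (x : A)

/-- The value on the component of degree `j` of `d * x ^ (2 * d)` times the extension of `δ`. -/
noncomputable def extendComponent (j : ZMod d) : A →ₗ[K] A :=
  (d : K) • (LinearMap.mulLeft K (x ^ (2 * d - (-j).val)) ∘ₗ δ ∘ₗ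
    LinearMap.mulRight K (x ^ (-j).val)) -
  ((-j).val : K) • LinearMap.mulRight K (x ^ d * δ (x ^ d))

/-- The linear map `d * x ^ (2 * d) * T`, where `T` is the extension of `δ`. -/
noncomputable def extendLinear : A →ₗ[K] A :=
  DirectSum.toModule K (ZMod d) A (fun j => extendComponent δ x j ∘ₗ (𝒜 j).subtype) ∘ₗ
    (DirectSum.decomposeLinearEquiv 𝒜).toLinearMap

theorem extendLinear_of_mem {j : ZMod d} {f : A} (hf : f ∈ 𝒜 j) :
    extendLinear 𝒜 δ x f = d * (x ^ (2 * d - (-j).val) * δ (f * x ^ (-j).val)) -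
      (-j).val * (f * (x ^ d * δ (x ^ d))) := by
  simp only [extendLinear, LinearMap.comp_apply, LinearEquiv.coe_coe,
    DirectSum.decomposeLinearEquiv_apply, DirectSum.decompose_of_mem 𝒜 hf]
  erw [DirectSum.toModule_lof]
  simp only [extendComponent, LinearMap.comp_apply, LinearMap.sub_apply, LinearMap.smul_apply,
    LinearMap.mulLeft_apply, LinearMap.mulRight_apply, Submodule.subtype_apply]
  simp only [Nat.cast_smul_eq_nsmul, nsmul_eq_mul]

variable [NeZero d] {𝒜 δ x} (hδ : ∀ f ∈ 𝒜 0, ∀ g ∈ 𝒜 0, δ (f * g) = δ f * g + f * δ g)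
include hδ

/-- The defining formula does not depend on the exponent chosen in the class of `-j`: raising it by
`d * q` is absorbed by the power rule for `x ^ d`. This freedom is needed for products, where the
sum of two reduced exponents may exceed `d`. -/
theorem pow_mul_extendLinear (hx : x ∈ 𝒜 1) {j : ZMod d} {f : A} (hf : f ∈ 𝒜 j) {k : ℕ}
    (hk : (k : ZMod d) = -j) :
    x ^ k * extendLinear 𝒜 δ x f =
      d * (x ^ (2 * d) * δ (f * x ^ k)) - k * (f * (x ^ d * x ^ k * δ (x ^ d))) := by
  obtain ⟨q, hq⟩ : ∃ q, k = (-j).val + d * q := by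
    refine ⟨k / d, ?_⟩
    rw [← hk, ZMod.val_natCast, Nat.mod_add_div]
  have hlt : (-j).val < d := ZMod.val_lt _
  have hj : ((-j).val : ZMod d) = -j := ZMod.natCast_zmod_val _
  rw [extendLinear_of_mem 𝒜 δ x hf]
  generalize (-j).val = r at *
  have hxd : x ^ d ∈ 𝒜 0 := pow_mem_zero 𝒜 hx
  have hfr : f * x ^ r ∈ 𝒜 0 := by
    have := SetLike.mul_mem_graded hf (SetLike.pow_mem_graded r hx)
    simpa [hj] using this
  have hxq : (x ^ d) ^ q ∈ 𝒜 0 := by simpa using SetLike.pow_mem_graded q hxd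
  have h1 : δ (f * x ^ k) = δ (f * x ^ r) * (x ^ d) ^ q + f * x ^ r * δ ((x ^ d) ^ q) := by
    rw [← hδ _ hfr _ hxq, hq, pow_add, pow_mul, mul_assoc]
  have h2 := mul_map_pow hδ hxd q
  have h3 : x ^ r * x ^ (2 * d - r) = (x ^ d) ^ 2 := by
    rw [← pow_add, ← pow_mul]; congr 1; omega
  have h4 : x ^ k = x ^ r * (x ^ d) ^ q := by rw [hq, pow_add, pow_mul]
  have h5 : x ^ (2 * d) = (x ^ d) ^ 2 := by rw [← pow_mul, mul_comm]
  rw [h1, h4, h5, hq]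
  push_cast
  linear_combination (d * (x ^ d) ^ q * δ (f * x ^ r)) * h3 - (d * x ^ d * f * x ^ r) * h2

theorem extendLinear_mul [IsDomain A] (hx : x ∈ 𝒜 1) (hx0 : x ≠ 0) (f g : A) :
    extendLinear 𝒜 δ x (f * g) =
      f * extendLinear 𝒜 δ x g + g * extendLinear 𝒜 δ x f := by
  induction f using DirectSum.Decomposition.inductionOn 𝒜 with
  | zero => simp
  | add a b ha hb => rw [add_mul, map_add, map_add, ha, hb]; ring
  | @homogeneous i f =>
  induction g using DirectSum.Decomposition.inductionOn 𝒜 with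
  | zero => simp
  | add a b ha hb => rw [mul_add, map_add, map_add, ha, hb]; ring
  | @homogeneous j g =>
  obtain ⟨f, hf⟩ := f
  obtain ⟨g, hg⟩ := g
  dsimp only
  have hk : ((-i).val : ZMod d) = -i := ZMod.natCast_zmod_val _
  have hl : ((-j).val : ZMod d) = -j := ZMod.natCast_zmod_val _
  generalize (-i).val = k at hk
  generalize (-j).val = l at hl
  have hkl : ((k + l : ℕ) : ZMod d) = -(i + j) := by push_cast; rw [hk, hl]; ring
  have h1 := pow_mul_extendLinear hδ hx hf hk
  have h2 := pow_mul_extendLinear hδ hx hg hl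
  have h3 := pow_mul_extendLinear hδ hx (SetLike.mul_mem_graded hf hg) hkl
  have hf0 : f * x ^ k ∈ 𝒜 0 := by
    simpa [hk] using SetLike.mul_mem_graded hf (SetLike.pow_mem_graded k hx)
  have hg0 : g * x ^ l ∈ 𝒜 0 := by
    simpa [hl] using SetLike.mul_mem_graded hg (SetLike.pow_mem_graded l hx)
  have h4 := hδ _ hf0 _ hg0
  rw [show f * x ^ k * (g * x ^ l) = f * g * x ^ (k + l) by ring] at h4
  refine mul_left_cancel₀ (pow_ne_zero (k + l) hx0) ?_
  rw [h3, h4]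
  push_cast
  linear_combination (-g * x ^ l) * h1 - (f * x ^ k) * h2

theorem extendLinear_zero_component (hx : x ∈ 𝒜 1) {f : A} (hf : f ∈ 𝒜 0) :
    extendLinear 𝒜 δ x f = d * (x ^ (2 * d) * δ f) := by
  simpa using pow_mul_extendLinear hδ hx hf (k := 0) (by simp)

/-- A derivation of the degree zero component of a `ZMod d`-graded domain extends to the whole
domain if the component of degree one contains a prime `x` and a nonmultiple of `x`. -/
theorem exists_derivation_extension [CharZero K] [IsDomain A] (hx : x ∈ 𝒜 1) (hxp : Prime x)
    {y : A} (hy : y ∈ 𝒜 1) (hxy : ¬ x ∣ y) :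
    ∃ T : Derivation K A A, ∀ f ∈ 𝒜 0, T f = δ f := by
  have : CharZero A := charZero_of_injective_algebraMap (algebraMap K A).injective
  have hd0 : (d : A) ≠ 0 := Nat.cast_ne_zero.2 (NeZero.ne d)
  have hdK : (d : K) ≠ 0 := Nat.cast_ne_zero.2 (NeZero.ne d)
  let E : Derivation K A A := Derivation.mk' (extendLinear 𝒜 δ x)
    (extendLinear_mul hδ hx hxp.ne_zero)
  have hE0 : ∀ f ∈ 𝒜 0, E f = d * (x ^ (2 * d) * δ f) := fun f hf =>
    extendLinear_zero_component hδ hx hf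
  have hEy : y ^ (d - 1) * E y = x ^ (2 * d) * δ (y ^ d) := by
    have h1 := hE0 _ (pow_mem_zero 𝒜 hy)
    rw [Derivation.leibniz_pow, nsmul_eq_mul, smul_eq_mul] at h1
    exact mul_left_cancel₀ hd0 h1
  have hdvd : ∀ f, x ^ (2 * d) ∣ E f := by
    intro f
    induction f using DirectSum.Decomposition.inductionOn 𝒜 with
    | zero => simp
    | add a b ha hb => rw [map_add]; exact dvd_add ha hb
    | @homogeneous j f =>
      obtain ⟨f, hf⟩ := f
      dsimp only
      have hl : ((-j).val : ZMod d) = -j := ZMod.natCast_zmod_val _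
      generalize (-j).val = l at hl
      have hf0 : f * y ^ l ∈ 𝒜 0 := by
        simpa [hl] using SetLike.mul_mem_graded hf (SetLike.pow_mem_graded l hy)
      have h1 := hE0 _ hf0
      rw [Derivation.leibniz, Derivation.leibniz_pow] at h1
      simp only [nsmul_eq_mul, smul_eq_mul] at h1
      -- Expand `E (f * y ^ l)` and multiply by `y ^ (d - 1)`, so that `hEy` replaces `E y`. For `l
      -- = 0` the truncated `l - 1` is harmless because of the factor `l`.
      refine hxp.pow_dvd_of_dvd_mul_left (2 * d)
        (fun h => hxy (hxp.dvd_of_dvd_pow h) : ¬ x ∣ y ^ (l + (d - 1))) ?_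
      refine ⟨y ^ (d - 1) * d * δ (f * y ^ l) - l * f * y ^ (l - 1) * δ (y ^ d), ?_⟩
      rw [pow_add]
      linear_combination y ^ (d - 1) * h1 - l * f * y ^ (l - 1) * hEy
  obtain ⟨T, hT⟩ := Derivation.exists_mul_eq ((d : K)⁻¹ • E)
    (pow_ne_zero (2 * d) hxp.ne_zero) fun f => by
      rw [Derivation.smul_apply]; exact dvd_smul_of_dvd _ (hdvd f)
  refine ⟨T, fun f hf => mul_left_cancel₀ (pow_ne_zero (2 * d) hxp.ne_zero) ?_⟩
  rw [hT, Derivation.smul_apply, hE0 f hf, ← nsmul_eq_mul, ← Nat.cast_smul_eq_nsmul K, smul_smul,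
    inv_mul_cancel₀ hdK, one_smul]

end GradedAlgebra

end Extension

/-! ### The grading of the free Poisson algebra -/

namespace FreePoissonAlgebra

section Generators

variable (K : Type*) [Field K] (n : ℕ)

/-- The linear map from the free Lie algebra to the polynomial algebra that sends generators to
variables and annihilates brackets. -/
noncomputable def toMvPolynomial : FreeLieAlgebra K (Fin n) →ₗ[K] MvPolynomial (Fin n) K :=
  letI := LieRing.ofAssociativeRing (A := MvPolynomial (Fin n) K)
  letI := LieAlgebra.ofAssociativeAlgebra (A := MvPolynomial (Fin n) K) (R := K)
  (FreeLieAlgebra.lift K (fun i : Fin n => (MvPolynomial.X i : MvPolynomial (Fin n) K)) :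
    FreeLieAlgebra K (Fin n) →ₗ⁅K⁆ MvPolynomial (Fin n) K).toLinearMap

theorem toMvPolynomial_of (i : Fin n) :
    toMvPolynomial K n (FreeLieAlgebra.of K i) = MvPolynomial.X i :=
  letI := LieRing.ofAssociativeRing (A := MvPolynomial (Fin n) K)
  letI := LieAlgebra.ofAssociativeAlgebra (A := MvPolynomial (Fin n) K) (R := K)
  FreeLieAlgebra.lift_of_apply _ i

theorem linearIndependent_of : LinearIndependent K (FreeLieAlgebra.of K : Fin n → _) := by
  refine LinearIndependent.of_comp (toMvPolynomial K n) ?_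
  rw [show toMvPolynomial K n ∘ FreeLieAlgebra.of K = MvPolynomial.X from
    funext (toMvPolynomial_of K n)]
  exact MvPolynomial.linearIndependent_X (Fin n) K

variable {K n}

/-- Extending `v` to a basis of `L` makes it a variable of a polynomial ring. -/
theorem _root_.SymmetricAlgebra.prime_ι {L : Type*} [AddCommGroup L] [Module K L] {v : L}
    (hv : v ≠ 0) : Prime (SymmetricAlgebra.ι K L v) := by
  have hli : LinearIndepOn K id {v} := LinearIndepOn.singleton hv
  let b := Module.Basis.extend hli
  have hvb : v ∈ hli.extend (Set.subset_univ _) := hli.subset_extend _ rfl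
  have h : SymmetricAlgebra.equivMvPolynomial b (SymmetricAlgebra.ι K L v) =
      MvPolynomial.X ⟨v, hvb⟩ := by
    have h := SymmetricAlgebra.equivMvPolynomial_ι_apply b ⟨v, hvb⟩
    rwa [Module.Basis.extend_apply_self] at h
  rw [← MulEquiv.prime_iff (SymmetricAlgebra.equivMvPolynomial b).toMulEquiv]
  change Prime (SymmetricAlgebra.equivMvPolynomial b (SymmetricAlgebra.ι K L v))
  rw [h]
  exact MvPolynomial.X_prime

theorem prime_X (i : Fin n) : Prime (X K n i) :=
  SymmetricAlgebra.prime_ι ((linearIndependent_of K n).ne_zero i)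

theorem not_X_dvd_X {i j : Fin n} (hij : i ≠ j) : ¬ X K n i ∣ X K n j := by
  intro h
  let ψ := SymmetricAlgebra.lift (toMvPolynomial K n)
  have hψ : ∀ i, ψ (X K n i) = MvPolynomial.X i := fun i =>
    (SymmetricAlgebra.lift_ι_apply _ _).trans (toMvPolynomial_of K n i)
  have h1 := map_dvd ψ h
  rw [hψ, hψ, MvPolynomial.X_dvd_X] at h1
  exact hij h1

theorem X_mem_dComponent (d : ℕ) (i : Fin n) : X K n i ∈ dComponent K n d 1 :=
  Submodule.subset_span ⟨1, by simp, ι_mem_homogeneous (.of i)⟩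

/-! ### Spanning and independence of the homogeneous components. -/

/-- The free Lie algebra is spanned by the Lie monomials. -/
theorem mem_span_isLieMonomial (e : FreeLieAlgebra K (Fin n)) :
    e ∈ Submodule.span K {e | ∃ m, IsLieMonomial K n m e} := by
  let S : LieSubalgebra K (FreeLieAlgebra K (Fin n)) :=
    { Submodule.span K {e | ∃ m, IsLieMonomial K n m e} with
      lie_mem' := by
        intro a b ha hb
        change a ∈ Submodule.span K _ at ha
        change b ∈ Submodule.span K _ at hb
        change ⁅a, b⁆ ∈ Submodule.span K _
        induction ha using Submodule.span_induction with
        | zero => simp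
        | add a a' _ _ ha ha' => rw [add_lie]; exact add_mem ha ha'
        | smul r a _ ha => rw [smul_lie]; exact Submodule.smul_mem _ _ ha
        | mem a ha =>
          induction hb using Submodule.span_induction with
          | zero => simp
          | add b b' _ _ hb hb' => rw [lie_add]; exact add_mem hb hb'
          | smul r b _ hb => rw [lie_smul]; exact Submodule.smul_mem _ _ hb
          | mem b hb =>
            obtain ⟨k, hk⟩ := ha
            obtain ⟨m, hm⟩ := hb
            exact Submodule.subset_span ⟨k + m, .lie hk hm⟩ }
  let φ : FreeLieAlgebra K (Fin n) →ₗ⁅K⁆ S :=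
    FreeLieAlgebra.lift K fun i => ⟨FreeLieAlgebra.of K i, Submodule.subset_span ⟨1, .of i⟩⟩
  -- Both sides fix the generators, so by freeness every element lies in the image of `S`.
  have h : S.incl.comp φ = LieHom.id := by
    ext i
    simp [φ]
  have he := (φ e).2
  rwa [show (φ e : FreeLieAlgebra K (Fin n)) = e from DFunLike.congr_fun h e] at he

theorem homogeneous_le_dComponent (d m : ℕ) : homogeneous K n m ≤ dComponent K n d m :=
  fun _ hf => Submodule.subset_span ⟨m, rfl, hf⟩

theorem iSup_homogeneous : ⨆ m, homogeneous K n m = ⊤ := by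
  rw [eq_top_iff]
  rintro f -
  have hmul : ∀ f g, f ∈ ⨆ m, homogeneous K n m → g ∈ ⨆ m, homogeneous K n m →
      f * g ∈ ⨆ m, homogeneous K n m := by
    intro f g hf hg
    induction hf using Submodule.iSup_induction' with
    | zero => simp
    | add a b _ _ ha hb => rw [add_mul]; exact add_mem ha hb
    | mem k f hf =>
      induction hg using Submodule.iSup_induction' with
      | zero => simp
      | add a b _ _ ha hb => rw [mul_add]; exact add_mem ha hb
      | mem m g hg => exact Submodule.mem_iSup_of_mem (k + m) (homogeneous_mul hf hg)
  induction f using SymmetricAlgebra.induction with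
  | algebraMap r =>
    rw [Algebra.algebraMap_eq_smul_one]
    exact Submodule.smul_mem _ _ (Submodule.mem_iSup_of_mem 0 one_mem_homogeneous)
  | ι x =>
    induction mem_span_isLieMonomial x using Submodule.span_induction with
    | zero => simp
    | add a b _ _ ha hb => rw [map_add]; exact add_mem ha hb
    | smul r a _ ha => rw [map_smul]; exact Submodule.smul_mem _ _ ha
    | mem e he =>
      obtain ⟨m, he⟩ := he
      exact Submodule.mem_iSup_of_mem m (ι_mem_homogeneous he)
  | mul a b ha hb => exact hmul a b ha hb
  | add a b ha hb => exact add_mem ha hb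

theorem dComponent_eq_iSup (d : ℕ) (i : ZMod d) :
    dComponent K n d i = ⨆ m ∈ {m : ℕ | (m : ZMod d) = i}, homogeneous K n m := by
  refine le_antisymm (Submodule.span_le.2 ?_) (iSup₂_le ?_)
  · rintro f ⟨m, hm, hf⟩
    exact Submodule.mem_iSup_of_mem m (Submodule.mem_iSup_of_mem hm hf)
  · rintro m rfl
    exact homogeneous_le_dComponent d m

theorem iSup_dComponent (d : ℕ) : ⨆ i, dComponent K n d i = ⊤ :=
  top_unique <| iSup_homogeneous.symm.le.trans <| iSup_le fun m =>
    (homogeneous_le_dComponent d m).trans (le_iSup (dComponent K n d) _)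

/-- The endomorphism of the free Poisson algebra multiplying all generators by `2`. -/
noncomputable def scaleTwo : FreePoissonAlgebra K n →ₐ[K] FreePoissonAlgebra K n :=
  SymmetricAlgebra.lift (SymmetricAlgebra.ι K _ ∘ₗ
    (FreeLieAlgebra.lift K fun i : Fin n => (2 : K) • FreeLieAlgebra.of K i :
      FreeLieAlgebra K (Fin n) →ₗ⁅K⁆ FreeLieAlgebra K (Fin n)).toLinearMap)

theorem scaleTwo_of_mem {m : ℕ} {f : FreePoissonAlgebra K n} (hf : f ∈ homogeneous K n m) :
    scaleTwo f = (2 : K) ^ m • f := by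
  have hlie : ∀ {m : ℕ} {e : FreeLieAlgebra K (Fin n)}, IsLieMonomial K n m e →
      (FreeLieAlgebra.lift K fun i : Fin n => (2 : K) • FreeLieAlgebra.of K i :
        FreeLieAlgebra K (Fin n) →ₗ⁅K⁆ FreeLieAlgebra K (Fin n)) e = (2 : K) ^ m • e := by
    intro m e he
    induction he with
    | of i => simp
    | lie _ _ ha hb => rw [LieHom.map_lie, ha, hb, smul_lie, lie_smul, smul_smul, pow_add]
  induction hf using Submodule.span_induction with
  | zero => simp
  | add a b _ _ ha hb => rw [map_add, ha, hb, smul_add]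
  | smul r a _ ha => rw [map_smul, ha, smul_comm]
  | mem u hu =>
    induction hu with
    | one => simp
    | mul he _ ih =>
      rw [map_mul, ih, scaleTwo, SymmetricAlgebra.lift_ι_apply, LinearMap.comp_apply]
      erw [hlie he]
      rw [map_smul, smul_mul_smul_comm, pow_add]

variable [CharZero K]

/-- Distinct degrees lie in eigenspaces of `scaleTwo` with distinct eigenvalues, since powers of `2`
are distinct in characteristic zero. -/
theorem iSupIndep_homogeneous : iSupIndep (homogeneous K n) := by
  have hinj : Function.Injective fun m : ℕ => (2 : K) ^ m := by
    intro a b hab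
    have : (2 : ℕ) ^ a = 2 ^ b := by
      dsimp only at hab
      exact_mod_cast hab
    exact Nat.pow_right_injective le_rfl this
  refine ((Module.End.eigenspaces_iSupIndep
    (scaleTwo (K := K) (n := n)).toLinearMap).comp hinj).mono fun m f hf => ?_
  exact Module.End.mem_eigenspace_iff.2 (scaleTwo_of_mem hf)

theorem iSupIndep_dComponent (d : ℕ) : iSupIndep (dComponent K n d) := by
  intro i
  have h : ⨆ j, ⨆ (_ : j ≠ i), dComponent K n d j ≤
      ⨆ m ∈ {m : ℕ | (m : ZMod d) ≠ i}, homogeneous K n m := by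
    refine iSup₂_le fun j hj => ?_
    rw [dComponent_eq_iSup]
    exact biSup_mono fun m (hm : (m : ZMod d) = j) => by simpa [hm] using hj
  rw [dComponent_eq_iSup]
  refine Disjoint.mono_right h (iSupIndep_homogeneous.disjoint_biSup_biSup ?_)
  exact Set.disjoint_left.2 fun m hm hm' => hm' hm

noncomputable instance instGradedAlgebraDComponent (d : ℕ) :
    GradedAlgebra (dComponent K n d) where
  one_mem := Submodule.subset_span ⟨0, by simp, one_mem_homogeneous⟩
  mul_mem _ _ _ _ hf hg := dComponent_mul hf hg
  toDecomposition := (DirectSum.isInternal_submodule_of_iSupIndep_of_iSup_eq_top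
    (iSupIndep_dComponent d) (iSup_dComponent d)).chooseDecomposition

end Generators

/-! ### Poisson derivations -/

section PoissonDerivation

variable {K : Type*} [Field K] [CharZero K] {n : ℕ}

open PoissonEnveloping in
/-- A derivation of the free Poisson algebra, regarded as a commutative algebra, that is compatible
with brackets of elements of the Veronese subalgebra is compatible with all brackets. -/
theorem derivation_bracket (d : ℕ) [NeZero d]
    (T : Derivation K (FreePoissonAlgebra K n) (FreePoissonAlgebra K n))
    (hT : ∀ f ∈ dComponent K n d 0, ∀ g ∈ dComponent K n d 0,
      T (bracketDer f g) = bracketDer (T f) g + bracketDer f (T g))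
    (f g : FreePoissonAlgebra K n) :
    T (bracketDer f g) = bracketDer (T f) g + bracketDer f (T g) := by
  have : CharZero (FreePoissonAlgebra K n) :=
    charZero_of_injective_algebraMap (algebraMap K (FreePoissonAlgebra K n)).injective
  -- `B f` is a derivation for each `f`, so `B f (g ^ d) = d g^{d-1} B f g`, and vanishing at `g ^
  -- d` gives vanishing at a homogeneous `g`.
  let B (f : FreePoissonAlgebra K n) := ⁅T, bracketDer f⁆ - bracketDer (T f)
  have hB : ∀ f g, B f g = T (bracketDer f g) - bracketDer f (T g) - bracketDer (T f) g := by
    intro f g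
    simp [B, Derivation.commutator_apply]
  have hskew : ∀ f g, B f g = -B g f := by
    intro f g
    rw [hB, hB, bracketDer_skew f g, bracketDer_skew f (T g), bracketDer_skew (T f) g, map_neg]
    ring
  have hpow : ∀ (f) (i : ZMod d), ∀ g ∈ dComponent K n d i, B f (g ^ d) = 0 → B f g = 0 := by
    intro f i g hg h
    rcases eq_or_ne g 0 with rfl | hg0
    · simp
    rw [Derivation.leibniz_pow, nsmul_eq_mul, smul_eq_mul] at h
    simpa [NeZero.ne d, hg0] using h
  have hext : ∀ f, (∀ (i : ZMod d), ∀ g ∈ dComponent K n d i, B f (g ^ d) = 0) →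
      ∀ g, B f g = 0 := by
    intro f h g
    induction g using DirectSum.Decomposition.inductionOn (dComponent K n d) with
    | zero => simp
    | add a b ha hb => rw [map_add, ha, hb, add_zero]
    | @homogeneous i g => exact hpow f i g g.2 (h i g g.2)
  have hzero : ∀ f ∈ dComponent K n d 0, ∀ g, B f g = 0 := by
    intro f hf
    refine hext f fun i g hg => ?_
    rw [hB, hT f hf _ (GradedAlgebra.pow_mem_zero _ hg)]
    ring
  -- Skewness moves the power `g ^ d` to the first argument, where `hzero` applies to it.
  have hall : B f g = 0 := by
    refine hext f (fun i g hg => ?_) g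
    rw [hskew, hzero _ (GradedAlgebra.pow_mem_zero _ hg), neg_zero]
  rw [hB] at hall
  linear_combination hall

/-- The projection of the free Poisson algebra onto the Veronese subalgebra. -/
noncomputable def veroneseProj (d : ℕ) : FreePoissonAlgebra K n →ₗ[K] veronese K n d where
  toFun f := ⟨DirectSum.decompose (dComponent K n d) f 0, SetLike.coe_mem _⟩
  map_add' f g := Subtype.ext (by simp)
  map_smul' r f := Subtype.ext (by
    rw [DirectSum.decompose_smul]
    rfl)

theorem veroneseProj_coe {d : ℕ} (f : veronese K n d) : veroneseProj d f.1 = f :=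
  Subtype.ext (DirectSum.decompose_of_mem_same (dComponent K n d) f.2)

end PoissonDerivation

end FreePoissonAlgebra

/-! ### The induced derivation of the free Poisson algebra. -/

theorem lemma3 {K : Type*} [Field K] [CharZero K] (n d : ℕ) (hn : 2 ≤ n) (hd : 2 ≤ d)
    (D : FreePoissonAlgebra.veronese K n d →ₗ[K] FreePoissonAlgebra.veronese K n d)
    (hD : IsPoissonDerivation D) (hDnil : IsLocallyNilpotent D) :
    ∃ S : FreePoissonAlgebra K n →ₗ[K] FreePoissonAlgebra K n,
      FreePoissonAlgebra.IsDGradedPoissonDerivation d S ∧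
      IsLocallyNilpotent S ∧
      ∀ f : FreePoissonAlgebra.veronese K n d,
        S (f : FreePoissonAlgebra K n) = (D f : FreePoissonAlgebra K n) := by
  have : NeZero d := ⟨by omega⟩
  -- `D` as a linear endomorphism of all of `P`; only its values on degree zero matter.
  let δ : FreePoissonAlgebra K n →ₗ[K] FreePoissonAlgebra K n :=
    (FreePoissonAlgebra.veronese K n d).val.toLinearMap ∘ₗ D ∘ₗ FreePoissonAlgebra.veroneseProj d
  have hδ : ∀ f : FreePoissonAlgebra.veronese K n d, δ f = D f := fun f => by simp [δ, FreePoissonAlgebra.veroneseProj_coe]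
  obtain ⟨T, hT⟩ := GradedAlgebra.exists_derivation_extension (𝒜 := FreePoissonAlgebra.dComponent K n d) (δ := δ)
    (fun f hf g hg => by
      have := congrArg Subtype.val (hD.map_mul ⟨f, hf⟩ ⟨g, hg⟩)
      rw [← hδ] at this
      refine this.trans ?_
      rw [show δ f = D ⟨f, hf⟩ from hδ ⟨f, hf⟩, show δ g = D ⟨g, hg⟩ from hδ ⟨g, hg⟩]
      rfl)
    -- Two distinct generators serve as the prime and its nonmultiple; here `2 ≤ n` enters.
    (FreePoissonAlgebra.X_mem_dComponent d ⟨0, by omega⟩) (FreePoissonAlgebra.prime_X _) (FreePoissonAlgebra.X_mem_dComponent d ⟨1, by omega⟩)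
    (FreePoissonAlgebra.not_X_dvd_X (by simp))
  have hTD : ∀ f : FreePoissonAlgebra.veronese K n d, T f = D f := fun f => (hT f f.2).trans (hδ f)
  have hT0 : ∀ f ∈ FreePoissonAlgebra.dComponent K n d 0, T f ∈ FreePoissonAlgebra.dComponent K n d 0 := fun f hf => by
    rw [show T f = D ⟨f, hf⟩ from hTD ⟨f, hf⟩]
    exact (D ⟨f, hf⟩).2
  have hiter : ∀ (k : ℕ) (f : FreePoissonAlgebra.veronese K n d), T^[k] f = (D^[k] f : FreePoissonAlgebra.veronese K n d) := by
    intro k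
    induction k with
    | zero => exact fun _ => rfl
    | succ k ih => exact fun f => by rw [Function.iterate_succ_apply, hTD, ih]; rfl
  refine ⟨T, ⟨⟨fun f g => ?_, ?_⟩, fun i => ?_⟩, ?_, hTD⟩
  · change T (f * g) = T f * g + f * T g
    rw [Derivation.leibniz, smul_eq_mul, smul_eq_mul]
    ring
  · refine FreePoissonAlgebra.derivation_bracket d T fun f hf g hg => ?_
    have h := congrArg Subtype.val (hD.map_bracket ⟨f, hf⟩ ⟨g, hg⟩)
    rw [← hTD] at h
    refine h.trans ?_
    rw [show T f = D ⟨f, hf⟩ from hTD ⟨f, hf⟩, show T g = D ⟨g, hg⟩ from hTD ⟨g, hg⟩]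
    rfl
  · exact GradedAlgebra.derivation_mem _ (by omega) T hT0 (FreePoissonAlgebra.X_mem_dComponent d i)
  · refine GradedAlgebra.isLocallyNilpotent (FreePoissonAlgebra.dComponent K n d) hd T hT0 fun f hf => ?_
    obtain ⟨k, hk⟩ := hDnil ⟨f, hf⟩
    refine ⟨k, (hiter k ⟨f, hf⟩).trans ?_⟩
    rw [hk]
    rfl
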